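/- Let $\mathbb K=\mathbb R$ or $\mathbb C$; manifolds are Hausdorff, without boundary, and smooth if $\mathbb K=\mathbb R$, holomorphic if $\mathbb K=\mathbb C$, with dimensions taken over $\mathbb K$; "smooth" below means holomorphic if $\mathbb K=\mathbb C$. A Poisson structure on a manifold $M$ is a smooth bivector field $\pi\in\Gamma(\wedge^2TM)$ whose bracket $\{f,g\}=\pi(df,dg)$ on local smooth functions satisfies the Jacobi identity; it is symplectic if $\pi^\#_m:T_m^*M\to T_mM$, $\beta(\pi^\#_m\alpha)=\pi_m(\alpha,\beta)$, is invertible for every $m\in M$. The singular locus of $\pi$ is the set of points $m\in M$ at which the rank of $\pi^\#_m$ is not maximal, i.e. is smaller than the rank of $\pi^\#_{m'}$ for some $m'\in M$. A symplectic resolution of a Poisson manifold $(M,\pi)$ is a triple $(\Sigma,\Pi,\varphi)$, where $(\Sigma,\Pi)$ is a symplectic Poisson manifold with $\dim\Sigma=\dim M$ and $\varphi:\Sigma\to M$ is a surjective Poisson morphism, i.e. a surjective smooth map with $\{f\circ\varphi,g\circ\varphi\}_\Sigma=\{f,g\}_M\circ\varphi$ for all local smooth functions $f,g$ on $M$. Let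 $(M,\pi)$ be a Poisson manifold of dimension $n\ge 4$ whose singular locus contains a non-empty embedded submanifold $P\subset M$ of codimension $1$. If $(M,\pi)$ admits a symplectic resolution $(\Sigma,\Pi,\varphi)$ with $\Sigma$ second countable, then $\pi$ does not vanish at all points of $P$: there is $p\in P$ with $\pi_p\ne 0$. -/

import Mathlib

open scoped Manifold ContDiff

noncomputable section

/-- The differential of a scalar function at `x`, as a cotangent vector in `T*ₓM`. -/
def cotangentDiff {𝕜 : Type*} [RCLike 𝕜] (E : Type*) [NormedAddCommGroup E] [NormedSpace 𝕜 E]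
    {M : Type*} [TopologicalSpace M] [ChartedSpace E M] (f : M → 𝕜) (x : M) :
    TangentSpace 𝓘(𝕜, E) x →L[𝕜] 𝕜 :=
  mfderiv 𝓘(𝕜, E) 𝓘(𝕜, 𝕜) f x

/-- The bracket `{f, g} = π(df, dg) = dg (π♯ df)` associated with a field of linear maps
`π♯ₓ : T*ₓM → TₓM`. -/
def sharpBracket {𝕜 : Type*} [RCLike 𝕜] {E : Type*} [NormedAddCommGroup E] [NormedSpace 𝕜 E]
    {M : Type*} [TopologicalSpace M] [ChartedSpace E M]
    (sharp : ∀ x : M, (TangentSpace 𝓘(𝕜, E) x →L[𝕜] 𝕜) →L[𝕜] TangentSpace 𝓘(𝕜, E) x)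
    (f g : M → 𝕜) (x : M) : 𝕜 :=
  cotangentDiff E g x (sharp x (cotangentDiff E f x))

/-- A Poisson structure on a manifold `M` without boundary modelled on the finite-dimensional
space `E`: smooth if `𝕜 = ℝ`, holomorphic if `𝕜 = ℂ` (where `C^∞` over `ℂ` means holomorphic).
The bivector field `π`, a section of `⋀²TM`, is given by the skew-symmetric maps
`π♯ₓ : T*ₓM → TₓM`, `β (π♯ₓ α) = πₓ(α, β)`. It is smooth, i.e. brackets of smooth local functions
are smooth, and its bracket of local functions satisfies the Jacobi identity. -/
structure PoissonStructure (𝕜 : Type*) [RCLike 𝕜] (E : Type*) [NormedAddCommGroup E]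
    [NormedSpace 𝕜 E] (M : Type*) [TopologicalSpace M] [ChartedSpace E M] where
  sharp : ∀ x : M, (TangentSpace 𝓘(𝕜, E) x →L[𝕜] 𝕜) →L[𝕜] TangentSpace 𝓘(𝕜, E) x
  skew : ∀ (x : M) (α : TangentSpace 𝓘(𝕜, E) x →L[𝕜] 𝕜), α (sharp x α) = 0
  smooth : ∀ (U : Set M), IsOpen U → ∀ f g : M → 𝕜,
    ContMDiffOn 𝓘(𝕜, E) 𝓘(𝕜, 𝕜) ∞ f U → ContMDiffOn 𝓘(𝕜, E) 𝓘(𝕜, 𝕜) ∞ g U →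
    ContMDiffOn 𝓘(𝕜, E) 𝓘(𝕜, 𝕜) ∞ (sharpBracket sharp f g) U
  jacobi : ∀ (U : Set M), IsOpen U → ∀ f g h : M → 𝕜,
    ContMDiffOn 𝓘(𝕜, E) 𝓘(𝕜, 𝕜) ∞ f U → ContMDiffOn 𝓘(𝕜, E) 𝓘(𝕜, 𝕜) ∞ g U →
    ContMDiffOn 𝓘(𝕜, E) 𝓘(𝕜, 𝕜) ∞ h U → ∀ x ∈ U,
    sharpBracket sharp f (sharpBracket sharp g h) x
      + sharpBracket sharp g (sharpBracket sharp h f) x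
      + sharpBracket sharp h (sharpBracket sharp f g) x = 0

namespace PoissonStructure

variable {𝕜 : Type*} [RCLike 𝕜] {E : Type*} [NormedAddCommGroup E] [NormedSpace 𝕜 E]
  {M : Type*} [TopologicalSpace M] [ChartedSpace E M]
  {F : Type*} [NormedAddCommGroup F] [NormedSpace 𝕜 F]
  {S : Type*} [TopologicalSpace S] [ChartedSpace F S]

/-- The Poisson bracket of two functions. -/
def bracket (π : PoissonStructure 𝕜 E M) (f g : M → 𝕜) : M → 𝕜 :=
  sharpBracket π.sharp f g

/-- The rank of the bivector at a point. -/
def rank (π : PoissonStructure 𝕜 E M) (x : M) : ℕ :=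
  Module.finrank 𝕜 (LinearMap.range (π.sharp x).toLinearMap)

/-- The singular locus: the points where `π♯` is not of maximal rank. -/
def singularLocus (π : PoissonStructure 𝕜 E M) : Set M :=
  {x | ¬ ∀ y, π.rank y ≤ π.rank x}

/-- A symplectic Poisson structure: the bivector is invertible at every point. -/
def IsSymplectic (π : PoissonStructure 𝕜 E M) : Prop :=
  ∀ x, Function.Bijective (π.sharp x)

/-- A smooth (holomorphic) map `φ : S → M` with `{φ*f, φ*g}_S = φ*{f, g}_M` for all local smooth
(holomorphic) functions `f`, `g` on `M`. -/
structure IsPoissonMorphism (πS : PoissonStructure 𝕜 F S) (πM : PoissonStructure 𝕜 E M)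
    (φ : S → M) : Prop where
  contMDiff : ContMDiff 𝓘(𝕜, F) 𝓘(𝕜, E) ∞ φ
  map_bracket : ∀ (U : Set M), IsOpen U → ∀ f g : M → 𝕜,
    ContMDiffOn 𝓘(𝕜, E) 𝓘(𝕜, 𝕜) ∞ f U → ContMDiffOn 𝓘(𝕜, E) 𝓘(𝕜, 𝕜) ∞ g U →
    ∀ s ∈ φ ⁻¹' U, πS.bracket (f ∘ φ) (g ∘ φ) s = πM.bracket f g (φ s)

/-- `(S, πS, φ)` is a symplectic resolution of `(M, πM)`: a symplectic manifold of the same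
dimension together with a surjective Poisson morphism. -/
structure IsSymplecticResolution (πS : PoissonStructure 𝕜 F S) (πM : PoissonStructure 𝕜 E M)
    (φ : S → M) : Prop where
  finrank_eq : Module.finrank 𝕜 F = Module.finrank 𝕜 E
  symplectic : πS.IsSymplectic
  morphism : IsPoissonMorphism πS πM φ
  surjective : Function.Surjective φ

end PoissonStructure

/-- An (embedded) submanifold of codimension `k` of a manifold `M` modelled on `E`: a subset that,
in suitable charts around each of its points, is a linear subspace of codimension `k`. -/
def IsSubmanifoldOfCodim (𝕜 : Type*) [RCLike 𝕜] (E : Type*) [NormedAddCommGroup E]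
    [NormedSpace 𝕜 E] {M : Type*} [TopologicalSpace M] [ChartedSpace E M]
    (k : ℕ) (P : Set M) : Prop :=
  ∀ p ∈ P, ∃ e ∈ IsManifold.maximalAtlas 𝓘(𝕜, E) ∞ M, p ∈ e.source ∧
    ∃ W : Submodule 𝕜 E, Module.finrank 𝕜 W + k = Module.finrank 𝕜 E ∧
      ∀ x ∈ e.source, x ∈ P ↔ e x ∈ W

end

/-!
Compatibility with the brackets says that `dφ ∘ Π♯ ∘ (dφ)* = π♯` along `φ`, and `Π♯` is invertible,
so linear algebra gives `2 rank dφ_s ≤ dim Σ + rank π_{φ(s)}`. On the other hand, composing `φ` with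
a submanifold chart of `M` and a linear projection onto the model space of `P` gives a map which, by
Sard's theorem, has a regular value corresponding to a point of `P`; over that point `dφ` has rank
at least `dim P = n - 1`. Together, `2 (n - 1) ≤ n + rank π_p` for some `p ∈ P`, so `π_p ≠ 0`.

Sard's theorem is proved following Milnor. Where all derivatives up to a high order `m` vanish, the
map is Hölder of exponent `m + 1` and its image has small Hausdorff dimension; the remaining zeros
of the differential lie in level sets of some iterated derivative whose own differential does not
vanish, hence in pieces of smaller dimension, where induction applies. Critical points at which the
rank is positive reduce to this case by straightening some of the coordinates and using Fubini.
-/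

open MeasureTheory Measure Set Filter Topology Module
open scoped NNReal ENNReal

section Calculus

variable {X : Type*} [NormedAddCommGroup X] [NormedSpace ℝ X]
  {Y : Type*} [NormedAddCommGroup Y] [NormedSpace ℝ Y]

theorem norm_sub_le_of_norm_fderiv_le_pow {h : X → Y} {B : Set X} (hB : Convex ℝ B)
    {C : ℝ} {m : ℕ} {x y : X} (hx : x ∈ B) (hy : y ∈ B) (hC : 0 ≤ C)
    (hd : ∀ z ∈ B, DifferentiableAt ℝ h z) (hb : ∀ z ∈ B, ‖fderiv ℝ h z‖ ≤ C * ‖z - x‖ ^ m) :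
    ‖h y - h x‖ ≤ C * ‖y - x‖ ^ (m + 1) := by
  rw [pow_succ, ← mul_assoc]
  refine (hB.inter (convex_closedBall x ‖y - x‖)).norm_image_sub_le_of_norm_hasFDerivWithin_le
    (f' := fderiv ℝ h) (fun z hz ↦ (hd z hz.1).hasFDerivAt.hasFDerivWithinAt)
    (fun z hz ↦ (hb z hz.1).trans ?_) ⟨hx, by simp⟩ ⟨hy, by simp [dist_eq_norm]⟩
  have : ‖z - x‖ ≤ ‖y - x‖ := by simpa [dist_eq_norm] using hz.2
  gcongr

theorem norm_sub_le_of_iteratedFDeriv_eq_zero {g : X → Y} {B : Set X} (hB : Convex ℝ B)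
    {C : ℝ} {m : ℕ} {x y : X} (hx : x ∈ B) (hy : y ∈ B)
    (hg : ∀ z ∈ B, ContDiffAt ℝ (m + 1) g z)
    (hC : ∀ z ∈ B, ‖iteratedFDeriv ℝ (m + 1) g z‖ ≤ C)
    (h0 : ∀ j, 1 ≤ j → j ≤ m → iteratedFDeriv ℝ j g x = 0) :
    ‖g y - g x‖ ≤ C * ‖y - x‖ ^ (m + 1) := by
  have hC0 : 0 ≤ C := (norm_nonneg _).trans (hC x hx)
  have hdiff (j : ℕ) (hj : j ≤ m) : ∀ z ∈ B, DifferentiableAt ℝ (iteratedFDeriv ℝ j g) z :=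
    fun z hz ↦ (hg z hz).differentiableAt_iteratedFDeriv (by exact_mod_cast Nat.lt_succ_of_le hj)
  have hbound (i : ℕ) : ∀ j, 1 ≤ j → j + i = m + 1 →
      ∀ z ∈ B, ‖iteratedFDeriv ℝ j g z‖ ≤ C * ‖z - x‖ ^ i := by
    induction i with
    | zero => rintro _ - rfl; simpa using hC
    | succ i ih =>
      intro j hj hji z hz
      have := norm_sub_le_of_norm_fderiv_le_pow hB hx hz hC0 (hdiff j (by omega)) fun w hw ↦
        norm_fderiv_iteratedFDeriv.trans_le (ih (j + 1) (by omega) (by omega) w hw)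
      rwa [h0 j hj (by omega), sub_zero] at this
  refine norm_sub_le_of_norm_fderiv_le_pow hB hx hy hC0
    (fun z hz ↦ (hg z hz).differentiableAt (by simp)) fun z hz ↦ ?_
  simpa [norm_iteratedFDeriv_one] using hbound m 1 le_rfl (add_comm 1 m) z hz

end Calculus

section Null

theorem measure_image_null_of_locally_null {X Y : Type*} [TopologicalSpace X]
    [SecondCountableTopology X] [MeasurableSpace Y] {ν : Measure Y} {f : X → Y} {K : Set X}
    (h : ∀ a ∈ K, ∃ V ∈ 𝓝[K] a, ν (f '' V) = 0) : ν (f '' K) = 0 := by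
  have := measure_null_of_locally_null (μ := OuterMeasure.comap f ν.toOuterMeasure) K
  simpa [OuterMeasure.comap_apply] using this (by simpa [OuterMeasure.comap_apply] using h)

variable {X : Type*} [NormedAddCommGroup X] [NormedSpace ℝ X] [FiniteDimensional ℝ X]
  {Y : Type*} [NormedAddCommGroup Y] [NormedSpace ℝ Y]

theorem dimH_image_le_of_iteratedFDeriv_eq_zero {g : X → Y} {Z : Set X} {m : ℕ}
    (hg : ∀ x ∈ Z, ContDiffAt ℝ (m + 1) g x)
    (h0 : ∀ x ∈ Z, ∀ j, 1 ≤ j → j ≤ m → iteratedFDeriv ℝ j g x = 0) :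
    dimH (g '' Z) ≤ finrank ℝ X / (m + 1) := by
  have hholder : ∀ a ∈ Z, ∃ C : ℝ≥0, ∃ t ∈ 𝓝[Z] a, HolderOnWith C ((m + 1 : ℕ) : ℝ≥0) g t := by
    intro a ha
    have hcont : ContinuousAt (iteratedFDeriv ℝ (m + 1) g) a :=
      ((hg a ha).iteratedFDeriv_right (m := 0) (by simp)).continuousAt
    obtain ⟨δ, hδ, hball⟩ := Metric.eventually_nhds_iff_ball.1 <|
      ((hg a ha).eventually (by simp)).and (hcont.norm.eventually_le_const (lt_add_one _))
    refine ⟨‖iteratedFDeriv ℝ (m + 1) g a‖₊ + 1, Z ∩ Metric.ball a δ,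
      inter_mem_nhdsWithin Z (Metric.ball_mem_nhds a hδ), fun x hx y hy ↦ ?_⟩
    have hle := norm_sub_le_of_iteratedFDeriv_eq_zero (convex_ball a δ) hy.2 hx.2
      (fun z hz ↦ (hball z hz).1) (fun z hz ↦ (hball z hz).2) (h0 y hy.1)
    rw [edist_nndist, edist_nndist, NNReal.coe_natCast, ENNReal.rpow_natCast]
    norm_cast
    simpa [← NNReal.coe_le_coe, dist_eq_norm] using hle
  calc dimH (g '' Z) ≤ dimH Z / ((m + 1 : ℕ) : ℝ≥0) :=
        dimH_image_le_of_locally_holder_on (by positivity) hholder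
    _ ≤ finrank ℝ X / (m + 1) := by
        rw [← Real.dimH_univ_eq_finrank X]
        push_cast
        gcongr
        exact subset_univ Z

end Null

section InverseFunction

variable {𝕜 : Type*} [RCLike 𝕜] {X : Type*} [NormedAddCommGroup X] [NormedSpace 𝕜 X]
  [CompleteSpace X] {n : ℕ∞ω} {Ω : Set X} {a : X}

theorem exists_openPartialHomeomorph_contDiffOn_symm {Y : Type*} [NormedAddCommGroup Y]
    [NormedSpace 𝕜 Y] {h : X → Y} (hΩ : IsOpen Ω) (ha : a ∈ Ω) (hn : n ≠ 0)
    (hh : ContDiffOn 𝕜 n h Ω) (hinv : (fderiv 𝕜 h a).IsInvertible) :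
    ∃ Φ : OpenPartialHomeomorph X Y, ⇑Φ = h ∧ a ∈ Φ.source ∧ Φ.source ⊆ Ω ∧
      ContDiffOn 𝕜 n Φ.symm Φ.target := by
  obtain ⟨A, hA⟩ := hinv
  have hha := hh.contDiffAt (hΩ.mem_nhds ha)
  have hA' : HasFDerivAt h (A : X →L[𝕜] Y) a := hA ▸ (hha.differentiableAt hn).hasFDerivAt
  let Ω' : Set X := Ω ∩ fderiv 𝕜 h ⁻¹' range ((↑) : (X ≃L[𝕜] Y) → X →L[𝕜] Y)
  have hΩ' : IsOpen Ω' := (hh.continuousOn_fderiv_of_isOpen hΩ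
    (ENat.one_le_iff_ne_zero_withTop.2 hn)).isOpen_inter_preimage hΩ ContinuousLinearEquiv.isOpen
  refine ⟨(hha.toOpenPartialHomeomorph h hA' hn).restrOpen Ω' hΩ', rfl,
    ⟨hha.mem_toOpenPartialHomeomorph_source hA' hn, ha, A, hA⟩, fun x hx ↦ hx.2.1, ?_⟩
  intro y hy
  obtain ⟨-, hxΩ, B, hB⟩ := OpenPartialHomeomorph.map_target _ hy
  have hhx := hh.contDiffAt (hΩ.mem_nhds hxΩ)
  exact (OpenPartialHomeomorph.contDiffAt_symm _ hy
    (hB ▸ (hhx.differentiableAt hn).hasFDerivAt) hhx).contDiffWithinAt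

theorem exists_openPartialHomeomorph_fst_eq {R : Type*} [NormedAddCommGroup R] [NormedSpace 𝕜 R]
    [FiniteDimensional 𝕜 R] {u : X → R} (hΩ : IsOpen Ω) (ha : a ∈ Ω) (hn : n ≠ 0)
    (hu : ContDiffOn 𝕜 n u Ω) (hsurj : (fderiv 𝕜 u a).range = ⊤) :
    ∃ Φ : OpenPartialHomeomorph X (R × (fderiv 𝕜 u a).ker), (∀ x, (Φ x).1 = u x) ∧
      a ∈ Φ.source ∧ Φ.source ⊆ Ω ∧ ContDiffOn 𝕜 n Φ.symm Φ.target := by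
  have := FiniteDimensional.complete 𝕜 R
  have hstrict : HasStrictFDerivAt u (fderiv 𝕜 u a) a :=
    (hu.contDiffAt (hΩ.mem_nhds ha)).hasStrictFDerivAt hn
  let data := HasStrictFDerivAt.implicitFunctionDataOfComplemented u _ hstrict hsurj
    (ContinuousLinearMap.ker_closedComplemented_of_finiteDimensional_range _)
  have hdata : ContDiffOn 𝕜 n data.prodFun Ω :=
    hu.prodMk ((ContinuousLinearMap.contDiff _).comp
      (contDiff_id.sub contDiff_const)).contDiffOn
  obtain ⟨Φ, hΦ, hΦ'⟩ := exists_openPartialHomeomorph_contDiffOn_symm hΩ ha hn hdata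
    data.isInvertible_fderiv_prodFun
  exact ⟨Φ, fun x ↦ by rw [hΦ]; rfl, hΦ'⟩

end InverseFunction

section CriticalPoints

variable {X : Type*} [NormedAddCommGroup X] [NormedSpace ℝ X] [FiniteDimensional ℝ X]
  {Y : Type*} [NormedAddCommGroup Y] [NormedSpace ℝ Y] {Ω : Set X}

theorem exists_contDiffOn_submodule_levelSet_subset {V : Type*} [NormedAddCommGroup V]
    [NormedSpace ℝ V] {n : ℕ∞ω} {u : X → V} {a : X} (hΩ : IsOpen Ω) (ha : a ∈ Ω) (hn : n ≠ 0)
    (hu : ContDiffOn ℝ n u Ω) (hne : fderiv ℝ u a ≠ 0) :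
    ∃ N : Submodule ℝ X, finrank ℝ N < finrank ℝ X ∧ ∃ (Ω' : Set N) (γ : N → X), IsOpen Ω' ∧
      ContDiffOn ℝ n γ Ω' ∧ MapsTo γ Ω' Ω ∧ ∃ U ∈ 𝓝 a, {x ∈ U | u x = u a} ⊆ γ '' Ω' := by
  obtain ⟨w, hw⟩ := DFunLike.ne_iff.1 hne
  obtain ⟨ℓ, -, hℓ⟩ := exists_dual_vector ℝ (fderiv ℝ u a w) (norm_ne_zero_iff.2 hw)
  have hfderiv : fderiv ℝ (ℓ ∘ u) a = ℓ ∘L fderiv ℝ u a :=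
    (ℓ.hasFDerivAt.comp a
      ((hu.contDiffAt (hΩ.mem_nhds ha)).differentiableAt hn).hasFDerivAt).fderiv
  have hneℓ : fderiv ℝ (ℓ ∘ u) a w ≠ 0 := by
    rw [hfderiv, ContinuousLinearMap.comp_apply, hℓ]
    simpa using hw
  obtain ⟨Φ, hfst, haΦ, hΦΩ, hsymm⟩ := exists_openPartialHomeomorph_fst_eq hΩ ha hn
    (ℓ.contDiff.comp_contDiffOn hu) (LinearMap.range_eq_top.2 (LinearMap.surjective fun h ↦
      hneℓ (by simpa using DFunLike.congr_fun h w)))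
  have hmk : ContDiff ℝ n fun t : (fderiv ℝ (ℓ ∘ u) a).ker ↦ (ℓ (u a), t) :=
    contDiff_const.prodMk contDiff_id
  refine ⟨_, Submodule.finrank_lt fun h ↦ hneℓ (h ▸ Submodule.mem_top : w ∈ _),
    (fun t ↦ (ℓ (u a), t)) ⁻¹' Φ.target, fun t ↦ Φ.symm (ℓ (u a), t),
    Φ.open_target.preimage hmk.continuous, hsymm.comp hmk.contDiffOn fun _ ht ↦ ht,
    fun t ht ↦ hΦΩ (Φ.map_target ht), Φ.source, Φ.open_source.mem_nhds haΦ, ?_⟩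
  rintro x ⟨hx, hux⟩
  have hΦx : (ℓ (u a), (Φ x).2) = Φ x := Prod.ext (by simp [hfst, hux]) rfl
  exact ⟨(Φ x).2, by simpa [hΦx] using Φ.map_source hx, by simp [hΦx, hx]⟩

variable [MeasurableSpace Y] [BorelSpace Y]

theorem hausdorffMeasure_image_iteratedFDeriv_stratum_eq_zero {d : ℝ} {g : X → Y} (k : ℕ)
    (hΩ : IsOpen Ω) (hg : ContDiffOn ℝ ∞ g Ω)
    (ih : ∀ N : Submodule ℝ X, finrank ℝ N < finrank ℝ X → ∀ (Ω' : Set N) (h : N → Y),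
      IsOpen Ω' → ContDiffOn ℝ ∞ h Ω' → μH[d] (h '' {t ∈ Ω' | fderiv ℝ h t = 0}) = 0) :
    μH[d] (g '' {x ∈ Ω | fderiv ℝ g x = 0 ∧ iteratedFDeriv ℝ k g x = 0 ∧
      iteratedFDeriv ℝ (k + 1) g x ≠ 0}) = 0 := by
  refine measure_image_null_of_locally_null fun a ⟨haΩ, _, hka, hka'⟩ ↦ ?_
  have hk : ContDiffOn ℝ ∞ (iteratedFDeriv ℝ k g) Ω := fun x hx ↦
    ((hg.contDiffAt (hΩ.mem_nhds hx)).iteratedFDeriv_right (mod_cast le_top)).contDiffWithinAt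
  have hne : fderiv ℝ (iteratedFDeriv ℝ k g) a ≠ 0 := fun h ↦
    hka' (by ext v; simp [iteratedFDeriv_succ_apply_left, h])
  obtain ⟨N, hN, Ω', γ, hΩ', hγ, hmaps, U, hU, hsub⟩ :=
    exists_contDiffOn_submodule_levelSet_subset hΩ haΩ (by simp) hk hne
  refine ⟨_, inter_mem_nhdsWithin _ hU, measure_mono_null ?_
    (ih N hN Ω' (g ∘ γ) hΩ' (hg.comp hγ hmaps))⟩
  rintro _ ⟨x, ⟨⟨hxΩ, hgx, hkx, -⟩, hxU⟩, rfl⟩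
  obtain ⟨t, ht, rfl⟩ := hsub ⟨hxU, hkx.trans hka.symm⟩
  refine ⟨t, ⟨ht, ?_⟩, rfl⟩
  rw [fderiv_comp t ((hg.contDiffAt (hΩ.mem_nhds hxΩ)).differentiableAt (by simp))
    ((hγ.contDiffAt (hΩ'.mem_nhds ht)).differentiableAt (by simp)), hgx,
    ContinuousLinearMap.zero_comp]

theorem hausdorffMeasure_image_fderiv_eq_zero {d : ℝ≥0} (hd : 0 < d) {g : X → Y}
    (hΩ : IsOpen Ω) (hg : ContDiffOn ℝ ∞ g Ω) :
    μH[d] (g '' {x ∈ Ω | fderiv ℝ g x = 0}) = 0 := by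
  induction hr : finrank ℝ X using Nat.strong_induction_on generalizing X with
  | _ r ih =>
  obtain ⟨m, hm⟩ := exists_nat_gt (finrank ℝ X / d)
  let flat : Set X := {x ∈ Ω | ∀ j, 1 ≤ j → j ≤ m → iteratedFDeriv ℝ j g x = 0}
  have hflat : μH[d] (g '' flat) = 0 := by
    have hdim : dimH (g '' flat) ≤ (finrank ℝ X / (m + 1) : ℝ≥0) := by
      simpa using dimH_image_le_of_iteratedFDeriv_eq_zero (Z := flat) (m := m)
        (fun x hx ↦ (hg.contDiffAt (hΩ.mem_nhds hx.1)).of_le (mod_cast le_top)) fun x hx ↦ hx.2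
    refine hausdorffMeasure_of_dimH_lt (hdim.trans_lt ?_)
    rw [ENNReal.coe_lt_coe, div_lt_comm₀ (by positivity) hd]
    exact hm.trans (lt_add_one _)
  refine measure_mono_null ?_ (measure_union_null hflat (measure_iUnion_null fun k ↦
    hausdorffMeasure_image_iteratedFDeriv_stratum_eq_zero k hΩ hg
      fun N hN Ω' h hΩ' hh ↦ ih _ (hr ▸ hN) hΩ' hh rfl))
  rw [← image_iUnion, ← image_union]
  refine image_mono fun x hx ↦ or_iff_not_imp_right.2 fun hx' ↦ ⟨hx.1, fun j hj _ ↦ ?_⟩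
  have hsucc (k : ℕ) (hk : iteratedFDeriv ℝ k g x = 0) : iteratedFDeriv ℝ (k + 1) g x = 0 := by
    by_contra hne
    exact hx' (mem_iUnion.2 ⟨k, hx.1, hx.2, hk, hne⟩)
  induction j, hj using Nat.le_induction with
  | base => rw [← norm_eq_zero, norm_iteratedFDeriv_one, hx.2, norm_zero]
  | succ k _ hk => exact hsucc k (hk (by omega))

end CriticalPoints

section Fibred

variable {R : Type*} [NormedAddCommGroup R] [NormedSpace ℝ R] [FiniteDimensional ℝ R]
  [MeasurableSpace R] [BorelSpace R]
  {N : Type*} [NormedAddCommGroup N] [NormedSpace ℝ N] [FiniteDimensional ℝ N]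
  {Q : Type*} [NormedAddCommGroup Q] [NormedSpace ℝ Q] [FiniteDimensional ℝ Q]
  [MeasurableSpace Q] [BorelSpace Q]
  {H : R × N → R × Q} {Ω : Set (R × N)}

theorem hausdorffMeasure_image_eq_zero_of_isCompact_of_fderiv_comp_inr_eq_zero
    (hΩ : IsOpen Ω) (hH : ContDiffOn ℝ ∞ H Ω) (hfst : ∀ z ∈ Ω, (H z).1 = z.1)
    (hQ : 0 < finrank ℝ Q) {C : Set (R × N)} (hC : IsCompact C)
    (hCΩ : C ⊆ {z ∈ Ω | fderiv ℝ H z ∘L .inr ℝ R N = 0}) :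
    μH[finrank ℝ (R × Q)] (H '' C) = 0 := by
  have himage : IsCompact (H '' C) :=
    hC.image_of_continuousOn (hH.continuousOn.mono fun z hz ↦ (hCΩ hz).1)
  refine absolutelyContinuous_isAddHaarMeasure (μH[finrank ℝ (R × Q)] : Measure (R × Q))
    ((μH[finrank ℝ R] : Measure R).prod (μH[finrank ℝ Q] : Measure Q)) ?_
  rw [measure_prod_null himage.measurableSet]
  refine Eventually.of_forall fun u ↦ ?_
  have hmk (v : N) : HasFDerivAt (Prod.mk u) (.inr ℝ R N) v := hasFDerivAt_prodMk_right u v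
  have hslice := hausdorffMeasure_image_fderiv_eq_zero (d := finrank ℝ Q) (by exact_mod_cast hQ)
    (hΩ.preimage (Continuous.prodMk_right u)) (contDiff_snd.comp_contDiffOn (hH.comp
      (contDiff_prodMk_right u).contDiffOn fun _ hv ↦ hv))
  refine measure_mono_null ?_ hslice
  rintro q ⟨⟨u', v⟩, hz, hq⟩
  obtain ⟨hzΩ, hz'⟩ := hCΩ hz
  obtain rfl : u' = u := (hfst _ hzΩ).symm.trans (congrArg Prod.fst hq)
  refine ⟨v, ⟨hzΩ, ?_⟩, by simp [hq]⟩
  have hHz := ((hH.contDiffAt (hΩ.mem_nhds hzΩ)).differentiableAt (by simp)).hasFDerivAt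
  rw [(hasFDerivAt_snd.comp v (hHz.comp v (hmk v))).fderiv, hz', ContinuousLinearMap.comp_zero]

theorem hausdorffMeasure_image_fderiv_comp_inr_eq_zero
    (hΩ : IsOpen Ω) (hH : ContDiffOn ℝ ∞ H Ω) (hfst : ∀ z ∈ Ω, (H z).1 = z.1)
    (hQ : 0 < finrank ℝ Q) :
    μH[finrank ℝ (R × Q)] (H '' {z ∈ Ω | fderiv ℝ H z ∘L .inr ℝ R N = 0}) = 0 := by
  refine measure_image_null_of_locally_null fun a ⟨ha, _⟩ ↦ ?_
  obtain ⟨ε, hε, hball⟩ := Metric.nhds_basis_closedBall.mem_iff.1 (hΩ.mem_nhds ha)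
  have hcont : ContinuousOn (fun z ↦ fderiv ℝ H z ∘L .inr ℝ R N) (Metric.closedBall a ε) :=
    ((hH.continuousOn_fderiv_of_isOpen hΩ (by simp)).mono hball).clm_comp continuousOn_const
  refine ⟨Metric.closedBall a ε ∩ (fun z ↦ fderiv ℝ H z ∘L .inr ℝ R N) ⁻¹' {0},
    inter_mem (mem_nhdsWithin_of_mem_nhds (Metric.closedBall_mem_nhds a hε))
      (mem_of_superset self_mem_nhdsWithin fun z hz ↦ hz.2),
    hausdorffMeasure_image_eq_zero_of_isCompact_of_fderiv_comp_inr_eq_zero hΩ hH hfst hQ ?_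
      fun z hz ↦ ⟨hball hz.1, hz.2⟩⟩
  exact (isCompact_closedBall a ε).of_isClosed_subset
    (hcont.preimage_isClosed_of_isClosed Metric.isClosed_closedBall isClosed_singleton)
    inter_subset_left

end Fibred

section Sard

theorem apply_inr_eq_zero_of_finrank_range_le {K R N V : Type*} [Field K]
    [AddCommGroup R] [Module K R] [AddCommGroup N] [Module K N] [AddCommGroup V] [Module K V]
    [FiniteDimensional K R] [FiniteDimensional K N] (T : R × N →ₗ[K] V) (p : V →ₗ[K] R)
    (hp : ∀ z, p (T z) = z.1) (hT : finrank K T.range ≤ finrank K R) (b : N) : T (0, b) = 0 := by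
  have hsurj : Function.Surjective (p ∘ₗ T.range.subtype) := fun a ↦ ⟨⟨T (a, 0), _, rfl⟩, hp _⟩
  have hinj := (LinearMap.injective_iff_surjective_of_finrank_eq_finrank
    (hT.antisymm (LinearMap.finrank_le_finrank_of_surjective hsurj))).2 hsurj
  exact congrArg Subtype.val (@hinj ⟨T (0, b), _, rfl⟩ 0 (by simpa using hp (0, b)))

variable {X : Type*} [NormedAddCommGroup X] [NormedSpace ℝ X] [FiniteDimensional ℝ X]
  {Ω : Set X} {a : X}

theorem finrank_range_fderiv_comp_le {Y Z : Type*} [NormedAddCommGroup Y] [NormedSpace ℝ Y]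
    [NormedAddCommGroup Z] [NormedSpace ℝ Z] {g : X → Y} {f : Z → X} {z : Z}
    (hg : DifferentiableAt ℝ g (f z)) (hf : DifferentiableAt ℝ f z) :
    finrank ℝ (fderiv ℝ (g ∘ f) z).range ≤ finrank ℝ (fderiv ℝ g (f z)).range := by
  rw [fderiv_comp z hg hf]
  exact Submodule.finrank_mono (LinearMap.range_comp_le_range _ _)

theorem exists_nhds_hausdorffMeasure_image_finrank_range_le_eq_zero
    {R Q : Type*} [NormedAddCommGroup R] [NormedSpace ℝ R] [FiniteDimensional ℝ R]
    [MeasurableSpace R] [BorelSpace R] [NormedAddCommGroup Q] [NormedSpace ℝ Q]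
    [FiniteDimensional ℝ Q] [MeasurableSpace Q] [BorelSpace Q] {F : X → R × Q}
    (hΩ : IsOpen Ω) (hF : ContDiffOn ℝ ∞ F Ω) (ha : a ∈ Ω)
    (hsurj : (fderiv ℝ (Prod.fst ∘ F) a).range = ⊤) (hQ : 0 < finrank ℝ Q) :
    ∃ U ∈ 𝓝 a, μH[finrank ℝ (R × Q)]
      (F '' {x ∈ U | finrank ℝ (fderiv ℝ F x).range ≤ finrank ℝ R}) = 0 := by
  obtain ⟨Φ, hfst, haΦ, hΦΩ, hsymm⟩ := exists_openPartialHomeomorph_fst_eq hΩ ha (by simp)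
    (contDiff_fst.comp_contDiffOn hF) hsurj
  have hfst' : ∀ z ∈ Φ.target, (F (Φ.symm z)).1 = z.1 := fun z hz ↦
    (hfst (Φ.symm z)).symm.trans (congrArg Prod.fst (Φ.right_inv hz))
  have hmaps : MapsTo Φ.symm Φ.target Ω := fun z hz ↦ hΦΩ (Φ.map_target hz)
  have hH : ContDiffOn ℝ ∞ (F ∘ Φ.symm) Φ.target := hF.comp hsymm hmaps
  refine ⟨Φ.source, Φ.open_source.mem_nhds haΦ, measure_mono_null ?_
    (hausdorffMeasure_image_fderiv_comp_inr_eq_zero Φ.open_target hH hfst' hQ)⟩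
  rintro _ ⟨x, ⟨hx, hrank⟩, rfl⟩
  obtain ⟨z, hz, rfl⟩ : ∃ z ∈ Φ.target, Φ.symm z = x := ⟨Φ x, Φ.map_source hx, Φ.left_inv hx⟩
  have hnhds := Φ.open_target.mem_nhds hz
  refine ⟨z, ⟨hz, ?_⟩, rfl⟩
  have hfderiv_fst : .fst ℝ R Q ∘L fderiv ℝ (F ∘ Φ.symm) z = .fst ℝ R _ :=
    (hasFDerivAt_fst.comp _ ((hH.contDiffAt hnhds).differentiableAt (by simp)).hasFDerivAt).unique
      (hasFDerivAt_fst.congr_of_eventuallyEq (eventually_of_mem hnhds hfst'))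
  ext1 b
  refine apply_inr_eq_zero_of_finrank_range_le (fderiv ℝ (F ∘ Φ.symm) z).toLinearMap
    (LinearMap.fst ℝ R Q) (DFunLike.congr_fun hfderiv_fst) (le_trans ?_ hrank) b
  exact finrank_range_fderiv_comp_le
    ((hF.contDiffAt (hΩ.mem_nhds (hmaps hz))).differentiableAt (by simp))
    ((hsymm.contDiffAt hnhds).differentiableAt (by simp))

variable {Y : Type*} [NormedAddCommGroup Y] [NormedSpace ℝ Y] [FiniteDimensional ℝ Y]
  [MeasurableSpace Y] [BorelSpace Y] {f : X → Y}

theorem exists_nhds_hausdorffMeasure_image_finrank_range_fderiv_le_eq_zero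
    (hΩ : IsOpen Ω) (hf : ContDiffOn ℝ ∞ f Ω) (ha : a ∈ Ω)
    (hcrit : ¬ Function.Surjective (fderiv ℝ f a)) :
    ∃ U ∈ 𝓝 a, μH[finrank ℝ Y] (f '' {x ∈ U |
      finrank ℝ (fderiv ℝ f x).range ≤ finrank ℝ (fderiv ℝ f a).range}) = 0 := by
  obtain ⟨Q, hRQ⟩ := (fderiv ℝ f a).range.exists_isCompl
  let e : ((fderiv ℝ f a).range × Q) ≃L[ℝ] Y :=
    (Submodule.prodEquivOfIsCompl _ Q hRQ).toContinuousLinearEquiv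
  have hF : ContDiffOn ℝ ∞ (e.symm ∘ f) Ω := e.symm.contDiff.comp_contDiffOn hf
  have hsurj : (fderiv ℝ (Prod.fst ∘ e.symm ∘ f) a).range = ⊤ := by
    rw [(hasFDerivAt_fst.comp a ((hF.contDiffAt (hΩ.mem_nhds ha)).differentiableAt
      (by simp)).hasFDerivAt).fderiv, e.symm.comp_fderiv, LinearMap.range_eq_top]
    rintro ⟨_, w, rfl⟩
    exact ⟨w, congrArg Prod.fst (Submodule.prodEquivOfIsCompl_symm_apply_left _ Q hRQ ⟨_, w, rfl⟩)⟩
  have hQ : 0 < finrank ℝ Q := by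
    have := Submodule.finrank_add_eq_of_isCompl hRQ
    have := Submodule.finrank_lt (mt LinearMap.range_eq_top.1 hcrit)
    omega
  obtain ⟨U, hU, hnull⟩ :=
    exists_nhds_hausdorffMeasure_image_finrank_range_le_eq_zero hΩ hF ha hsurj hQ
  rw [e.toLinearEquiv.finrank_eq] at hnull
  have hrank (x : X) :
      finrank ℝ (fderiv ℝ (e.symm ∘ f) x).range ≤ finrank ℝ (fderiv ℝ f x).range := by
    rw [e.symm.comp_fderiv, ContinuousLinearMap.toLinearMap_comp, LinearMap.range_comp]
    exact Submodule.finrank_map_le _ _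
  refine ⟨U, hU, measure_mono_null ?_ (nonpos_iff_eq_zero.1 <|
    (e.lipschitz.hausdorffMeasure_image_le (by positivity) _).trans_eq (by rw [hnull, mul_zero]))⟩
  rintro _ ⟨x, ⟨hxU, hx⟩, rfl⟩
  exact ⟨e.symm (f x), ⟨x, ⟨hxU, (hrank x).trans hx⟩, rfl⟩, e.apply_symm_apply _⟩

theorem hausdorffMeasure_image_not_surjective_fderiv_eq_zero
    (hΩ : IsOpen Ω) (hf : ContDiffOn ℝ ∞ f Ω) :
    μH[finrank ℝ Y] (f '' {x ∈ Ω | ¬ Function.Surjective (fderiv ℝ f x)}) = 0 := by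
  have hrank (k : ℕ) : μH[finrank ℝ Y] (f '' {x ∈ Ω | ¬ Function.Surjective (fderiv ℝ f x) ∧
      finrank ℝ (fderiv ℝ f x).range = k}) = 0 := by
    refine measure_image_null_of_locally_null fun a ⟨ha, hcrit, hk⟩ ↦ ?_
    obtain ⟨U, hU, hnull⟩ :=
      exists_nhds_hausdorffMeasure_image_finrank_range_fderiv_le_eq_zero hΩ hf ha hcrit
    refine ⟨_, inter_mem_nhdsWithin _ hU, measure_mono_null (image_mono ?_) hnull⟩
    rintro x ⟨⟨-, -, hx⟩, hxU⟩
    exact ⟨hxU, (hx.trans hk.symm).le⟩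
  refine measure_mono_null ?_ (measure_iUnion_null hrank)
  rintro _ ⟨x, ⟨hx, hcrit⟩, rfl⟩
  exact mem_iUnion.2 ⟨_, x, ⟨hx, hcrit, rfl⟩, rfl⟩

end Sard

section ManifoldSard

variable {𝕜 : Type*} [RCLike 𝕜] {Y : Type*} [NormedAddCommGroup Y] [NormedSpace 𝕜 Y]
  [FiniteDimensional 𝕜 Y] [MeasurableSpace Y] [BorelSpace Y] (μ : Measure Y) [μ.IsAddHaarMeasure]
  {X : Type*} [NormedAddCommGroup X] [NormedSpace 𝕜 X] [FiniteDimensional 𝕜 X]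

theorem addHaar_image_not_surjective_fderiv_eq_zero {f : X → Y} {Ω : Set X} (hΩ : IsOpen Ω)
    (hf : ContDiffOn 𝕜 ∞ f Ω) :
    μ (f '' {x ∈ Ω | ¬ Function.Surjective (fderiv 𝕜 f x)}) = 0 := by
  let _ : NormedSpace ℝ X := .restrictScalars ℝ 𝕜 X
  let _ : NormedSpace ℝ Y := .restrictScalars ℝ 𝕜 Y
  have : IsScalarTower ℝ 𝕜 X := RestrictScalars.isScalarTower ℝ 𝕜 X
  have : IsScalarTower ℝ 𝕜 Y := RestrictScalars.isScalarTower ℝ 𝕜 Y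
  have : FiniteDimensional ℝ X := .trans ℝ 𝕜 X
  have : FiniteDimensional ℝ Y := .trans ℝ 𝕜 Y
  refine absolutelyContinuous_isAddHaarMeasure μ μH[finrank ℝ Y] (measure_mono_null
    (image_mono ?_) (hausdorffMeasure_image_not_surjective_fderiv_eq_zero hΩ
      (hf.restrict_scalars ℝ)))
  rintro x ⟨hx, hcrit⟩
  refine ⟨hx, ?_⟩
  rwa [((hf.contDiffAt (hΩ.mem_nhds hx)).differentiableAt
    (by simp)).fderiv_restrictScalars ℝ]

theorem addHaar_image_not_surjective_mfderiv_eq_zero {S : Type*} [TopologicalSpace S]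
    [SecondCountableTopology S] [ChartedSpace X S] [IsManifold 𝓘(𝕜, X) ∞ S] {f : S → Y}
    {Ω : Set S} (hΩ : IsOpen Ω) (hf : ContMDiffOn 𝓘(𝕜, X) 𝓘(𝕜, Y) ∞ f Ω) :
    μ (f '' {s ∈ Ω | ¬ Function.Surjective (mfderiv 𝓘(𝕜, X) 𝓘(𝕜, Y) f s)}) = 0 := by
  refine measure_image_null_of_locally_null fun a _ ↦ ?_
  let c := chartAt X a
  have hopen : IsOpen (c.target ∩ c.symm ⁻¹' Ω) := c.isOpen_inter_preimage_symm hΩ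
  have hsymm : ContMDiffOn 𝓘(𝕜, X) 𝓘(𝕜, X) ∞ c.symm c.target := contMDiffOn_chart_symm
  have hg : ContDiffOn 𝕜 ∞ (f ∘ c.symm) (c.target ∩ c.symm ⁻¹' Ω) :=
    (hf.comp (hsymm.mono inter_subset_left) fun x hx ↦ hx.2).contDiffOn
  refine ⟨_, inter_mem_nhdsWithin _ (chart_source_mem_nhds X a), measure_mono_null ?_
    (addHaar_image_not_surjective_fderiv_eq_zero μ hopen hg)⟩
  rintro _ ⟨s, ⟨⟨hs, hcrit⟩, hsource⟩, rfl⟩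
  obtain ⟨x, hx, rfl⟩ : ∃ x ∈ c.target, c.symm x = s :=
    ⟨c s, c.map_source hsource, c.left_inv hsource⟩
  refine ⟨x, ⟨⟨hx, hs⟩, fun hsurj ↦ hcrit ?_⟩, rfl⟩
  rw [← mfderiv_eq_fderiv, mfderiv_comp x
    ((hf.contMDiffAt (hΩ.mem_nhds hs)).mdifferentiableAt (by simp))
    ((hsymm.contMDiffAt (c.open_target.mem_nhds hx)).mdifferentiableAt (by simp))] at hsurj
  exact Function.Surjective.of_comp hsurj

theorem exists_mem_forall_surjective_mfderiv {Y : Type*} [NormedAddCommGroup Y] [NormedSpace 𝕜 Y]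
    [FiniteDimensional 𝕜 Y] {S : Type*} [TopologicalSpace S] [SecondCountableTopology S]
    [ChartedSpace X S] [IsManifold 𝓘(𝕜, X) ∞ S] {f : S → Y} {Ω : Set S} (hΩ : IsOpen Ω)
    (hf : ContMDiffOn 𝓘(𝕜, X) 𝓘(𝕜, Y) ∞ f Ω) {U : Set Y} (hU : IsOpen U) (hUne : U.Nonempty) :
    ∃ y ∈ U, ∀ s ∈ Ω, f s = y → Function.Surjective (mfderiv 𝓘(𝕜, X) 𝓘(𝕜, Y) f s) := by
  borelize Y
  have : ProperSpace Y := FiniteDimensional.proper 𝕜 Y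
  by_contra! hcrit
  refine (hU.measure_pos addHaar hUne).ne' (measure_mono_null (fun y hy ↦ ?_)
    (addHaar_image_not_surjective_mfderiv_eq_zero addHaar hΩ hf))
  obtain ⟨s, hs, rfl, hsurj⟩ := hcrit y hy
  exact ⟨s, ⟨hs, hsurj⟩, rfl⟩

end ManifoldSard

section Resolution

theorem two_mul_finrank_range_le_finrank_add_finrank_range_comp_dualMap {K V W : Type*} [Field K]
    [AddCommGroup V] [Module K V] [FiniteDimensional K V] [AddCommGroup W] [Module K W]
    (D : V →ₗ[K] W) (B : Dual K V →ₗ[K] V) (hB : Function.Injective B) :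
    2 * finrank K D.range ≤ finrank K V + finrank K (D ∘ₗ B ∘ₗ D.dualMap).range := by
  have hU : finrank K (B ∘ₗ D.dualMap).range = finrank K D.range := by
    rw [LinearMap.range_comp, ← (Submodule.equivMapOfInjective B hB _).finrank_eq,
      LinearMap.finrank_range_dualMap_eq_finrank_range]
  have hmap := (D.domRestrict (B ∘ₗ D.dualMap).range).finrank_range_add_finrank_ker
  have hker : finrank K (D.domRestrict (B ∘ₗ D.dualMap).range).ker ≤ finrank K D.ker := by
    rw [LinearMap.ker_domRestrict, ← Submodule.finrank_map_subtype_eq,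
      Submodule.map_comap_subtype]
    exact Submodule.finrank_mono inf_le_right
  rw [LinearMap.range_domRestrict, ← LinearMap.range_comp] at hmap
  have := D.finrank_range_add_finrank_ker
  omega

variable {𝕜 : Type*} [RCLike 𝕜] {E : Type*} [NormedAddCommGroup E] [NormedSpace 𝕜 E]
  {M : Type*} [TopologicalSpace M] [ChartedSpace E M]
  {F : Type*} [NormedAddCommGroup F] [NormedSpace 𝕜 F]
  {S : Type*} [TopologicalSpace S] [ChartedSpace F S] {φ : S → M}

theorem IsSubmanifoldOfCodim.exists_finrank_le_finrank_range_mfderiv_add [FiniteDimensional 𝕜 E]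
    [FiniteDimensional 𝕜 F] [SecondCountableTopology S] [IsManifold 𝓘(𝕜, F) ∞ S] {k : ℕ}
    {P : Set M} (hP : IsSubmanifoldOfCodim 𝕜 E k P) (hPne : P.Nonempty)
    (hφ : ContMDiff 𝓘(𝕜, F) 𝓘(𝕜, E) ∞ φ) (hPφ : P ⊆ range φ) :
    ∃ s ∈ φ ⁻¹' P, finrank 𝕜 E ≤ finrank 𝕜 (mfderiv 𝓘(𝕜, F) 𝓘(𝕜, E) φ s).range + k := by
  obtain ⟨p, hp⟩ := hPne
  obtain ⟨e, he, hpe, W, hW, hPW⟩ := hP p hp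
  obtain ⟨l, hl⟩ := W.subtype.exists_leftInverse_of_injective W.ker_subtype
  let g : M → W := l.toContinuousLinearMap ∘ e
  have hg : ContMDiffOn 𝓘(𝕜, E) 𝓘(𝕜, W) ∞ g e.source :=
    l.toContinuousLinearMap.contMDiff.comp_contMDiffOn (contMDiffOn_of_mem_maximalAtlas he)
  have hopen : IsOpen ((↑) ⁻¹' e.target : Set W) := e.open_target.preimage continuous_subtype_val
  obtain ⟨w, hw, hregular⟩ := exists_mem_forall_surjective_mfderiv
    (e.open_source.preimage hφ.continuous) (hg.comp hφ.contMDiffOn fun _ hs ↦ hs) hopen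
    ⟨⟨e p, (hPW p hpe).1 hp⟩, e.map_source hpe⟩
  have hwP : e.symm w ∈ P :=
    (hPW _ (e.map_target hw)).2 ((e.right_inv hw).symm ▸ w.2)
  obtain ⟨s, hs⟩ := hPφ hwP
  have hsP : φ s ∈ P := hs ▸ hwP
  have hsource : φ s ∈ e.source := hs ▸ e.map_target hw
  have hgs : g (φ s) = w := by
    simpa [g, hs, e.right_inv hw] using LinearMap.congr_fun hl w
  have hsurj := hregular s hsource hgs
  rw [mfderiv_comp s ((hg.contMDiffAt (e.open_source.mem_nhds hsource)).mdifferentiableAt (by simp))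
    (hφ.mdifferentiableAt (by simp))] at hsurj
  let A : E →L[𝕜] W := mfderiv 𝓘(𝕜, E) 𝓘(𝕜, W) g (φ s)
  let D : F →L[𝕜] E := mfderiv 𝓘(𝕜, F) 𝓘(𝕜, E) φ s
  have hWD : finrank 𝕜 W ≤ finrank 𝕜 D.range :=
    LinearMap.finrank_le_finrank_of_surjective (f := A.toLinearMap.domRestrict D.range)
      fun w' ↦ let ⟨v, hv⟩ := hsurj w'; ⟨⟨D v, v, rfl⟩, hv⟩
  exact ⟨s, hsP, by rw [← hW]; exact Nat.add_le_add_right hWD k⟩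

variable [IsManifold 𝓘(𝕜, E) ∞ M] {π : PoissonStructure 𝕜 E M} {πS : PoissonStructure 𝕜 F S}

theorem exists_contMDiffOn_cotangentDiff_eq (x : M) (α : TangentSpace 𝓘(𝕜, E) x →L[𝕜] 𝕜) :
    ∃ f : M → 𝕜, ContMDiffOn 𝓘(𝕜, E) 𝓘(𝕜, 𝕜) ∞ f (chartAt E x).source ∧
      cotangentDiff E f x = α := by
  let γ : E →L[𝕜] 𝕜 := α
  have hchart : ContMDiffOn 𝓘(𝕜, E) 𝓘(𝕜, E) ∞ (chartAt E x) (chartAt E x).source :=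
    contMDiffOn_chart
  refine ⟨γ ∘ chartAt E x, γ.contMDiff.comp_contMDiffOn hchart, ?_⟩
  have hderiv := γ.hasMFDerivAt.comp x ((hchart.contMDiffAt
    (chart_source_mem_nhds E x)).mdifferentiableAt (by simp)).hasMFDerivAt
  rw [mfderiv_chartAt_eq_tangentCoordChange (mem_chart_source E x)] at hderiv
  refine hderiv.mfderiv.trans ?_
  ext v
  exact congrArg γ (tangentCoordChange_self (mem_extChartAt_source x))

namespace PoissonStructure.IsPoissonMorphism

theorem mfderiv_sharp_comp_mfderiv (hφ : IsPoissonMorphism πS π φ) (s : S)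
    (α : TangentSpace 𝓘(𝕜, E) (φ s) →L[𝕜] 𝕜) :
    mfderiv 𝓘(𝕜, F) 𝓘(𝕜, E) φ s (πS.sharp s (α ∘L mfderiv 𝓘(𝕜, F) 𝓘(𝕜, E) φ s)) =
      π.sharp (φ s) α := by
  have hdiff {f : M → 𝕜} (hf : ContMDiffOn 𝓘(𝕜, E) 𝓘(𝕜, 𝕜) ∞ f (chartAt E (φ s)).source) :
      cotangentDiff F (f ∘ φ) s = cotangentDiff E f (φ s) ∘L mfderiv 𝓘(𝕜, F) 𝓘(𝕜, E) φ s :=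
    mfderiv_comp s ((hf.contMDiffAt (chart_source_mem_nhds E _)).mdifferentiableAt (by simp))
      (hφ.contMDiff.mdifferentiableAt (by simp))
  obtain ⟨f, hf, rfl⟩ := exists_contMDiffOn_cotangentDiff_eq (φ s) α
  refine (SeparatingDual.eq_iff_forall_dual_eq (R := 𝕜) (V := E)).2 fun β ↦ ?_
  obtain ⟨g, hg, rfl⟩ := exists_contMDiffOn_cotangentDiff_eq (φ s) β
  have hbracket := hφ.map_bracket _ (chartAt E (φ s)).open_source f g hf hg s
    (mem_chart_source E (φ s))
  rwa [bracket, bracket, sharpBracket, sharpBracket, hdiff hf, hdiff hg] at hbracket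

theorem two_mul_finrank_range_mfderiv_le [FiniteDimensional 𝕜 E] [FiniteDimensional 𝕜 F]
    (hφ : IsPoissonMorphism πS π φ) (hS : πS.IsSymplectic) (s : S) :
    2 * finrank 𝕜 (mfderiv 𝓘(𝕜, F) 𝓘(𝕜, E) φ s).range ≤ finrank 𝕜 F + π.rank (φ s) := by
  let D : F →L[𝕜] E := mfderiv 𝓘(𝕜, F) 𝓘(𝕜, E) φ s
  let A : (E →L[𝕜] 𝕜) →L[𝕜] E := π.sharp (φ s)
  let toDual : Dual 𝕜 F ≃ₗ[𝕜] (F →L[𝕜] 𝕜) := LinearMap.toContinuousLinearMap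
  let B : Dual 𝕜 F →ₗ[𝕜] F := (πS.sharp s).toLinearMap ∘ₗ toDual.toLinearMap
  have hsub : (D.toLinearMap ∘ₗ B ∘ₗ D.toLinearMap.dualMap).range ≤ A.range := by
    rintro _ ⟨α, rfl⟩
    exact ⟨(LinearMap.toContinuousLinearMap α : E →L[𝕜] 𝕜),
      (hφ.mfderiv_sharp_comp_mfderiv s _).symm⟩
  refine (two_mul_finrank_range_le_finrank_add_finrank_range_comp_dualMap D.toLinearMap B
    ((hS s).1.comp toDual.injective)).trans ?_
  exact Nat.add_le_add_left (Submodule.finrank_mono hsub) _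

end PoissonStructure.IsPoissonMorphism

end Resolution

theorem mainTheorem6_general {𝕜 : Type*} [RCLike 𝕜] {E : Type*} [NormedAddCommGroup E]
    [NormedSpace 𝕜 E] [FiniteDimensional 𝕜 E] {M : Type*} [TopologicalSpace M] [ChartedSpace E M]
    [IsManifold 𝓘(𝕜, E) ∞ M] {π : PoissonStructure 𝕜 E M} {P : Set M} {k : ℕ}
    (hP : IsSubmanifoldOfCodim 𝕜 E k P) (hPne : P.Nonempty)
    {F : Type*} [NormedAddCommGroup F] [NormedSpace 𝕜 F] [FiniteDimensional 𝕜 F]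
    {S : Type*} [TopologicalSpace S] [SecondCountableTopology S] [ChartedSpace F S]
    [IsManifold 𝓘(𝕜, F) ∞ S] {πS : PoissonStructure 𝕜 F S} (hS : πS.IsSymplectic) {φ : S → M}
    (hφ : PoissonStructure.IsPoissonMorphism πS π φ) (hPφ : P ⊆ range φ) :
    ∃ p ∈ P, 2 * finrank 𝕜 E ≤ finrank 𝕜 F + π.rank p + 2 * k := by
  obtain ⟨s, hs, hrank⟩ :=
    hP.exists_finrank_le_finrank_range_mfderiv_add hPne hφ.contMDiff hPφ
  have := hφ.two_mul_finrank_range_mfderiv_le hS s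
  exact ⟨φ s, hs, by omega⟩

theorem mainTheorem6 {𝕜 : Type*} [RCLike 𝕜] (n : ℕ) (hn : 4 ≤ n)
    {E : Type*} [NormedAddCommGroup E] [NormedSpace 𝕜 E] [FiniteDimensional 𝕜 E]
    (hE : Module.finrank 𝕜 E = n)
    {M : Type*} [TopologicalSpace M] [T2Space M] [ChartedSpace E M] [IsManifold 𝓘(𝕜, E) ∞ M]
    (π : PoissonStructure 𝕜 E M)
    (P : Set M) (hP : IsSubmanifoldOfCodim 𝕜 E 1 P) (hPne : P.Nonempty)
    (hsing : P ⊆ π.singularLocus)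
    {F : Type*} [NormedAddCommGroup F] [NormedSpace 𝕜 F] [FiniteDimensional 𝕜 F]
    {S : Type*} [TopologicalSpace S] [T2Space S] [SecondCountableTopology S]
    [ChartedSpace F S] [IsManifold 𝓘(𝕜, F) ∞ S]
    (πS : PoissonStructure 𝕜 F S) (φ : S → M)
    (hres : PoissonStructure.IsSymplecticResolution πS π φ) :
    ¬ ∀ p ∈ P, π.sharp p = 0 := by
  intro hzero
  obtain ⟨p, hp, hrank⟩ := mainTheorem6_general hP hPne hres.symplectic hres.morphism
    fun q _ ↦ hres.surjective q
  have hp0 : π.rank p = 0 := by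
    rw [PoissonStructure.rank, hzero p hp, ContinuousLinearMap.toLinearMap_zero,
      LinearMap.range_zero, finrank_bot]
  have hFE := hres.finrank_eq
  omega
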